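/- Let $R$ be an associative ring with identity. A class $\mathcal C$ of left $R$-modules has the \emph{2-out-of-3 property} if, whenever two of the three modules in a short exact sequence $0\to A\to B\to C\to 0$ of left $R$-modules belong to $\mathcal C$, so does the third. A \emph{Vogel class} is a class of left $R$-modules that is closed under direct limits (over directed sets), has the 2-out-of-3 property, and contains all finitely generated projective left $R$-modules. The ring $R$ is \emph{left Vogel-regular} if the only Vogel class is the class of all left $R$-modules, and it is \emph{left coherent} if every finitely generated left ideal of $R$ is finitely presented. For an integer $n\ge 0$, a left $R$-module $F$ is \emph{finitely $n$-presented} if there is an exact sequence $F_n\to F_{n-1}\to\cdots\to F_0\to F\to 0$ with every $F_i$ a finitely generated projective left $R$-module. Let $\mathsf{FP}_n\text{-}\mathsf{Flat}(R^{op})$ be the class of all right $R$-modules $M$ such that $\operatorname{Tor}_1^R(M,F)=0$ for every finitely $n$-presented left $R$-module $F$, and let $$[\mathsf{FP}_n\text{-}\mathsf{Flat}(R^{op})]^{\top_1}=\{N \text{ a left } R\text{-module} : \operatorname{Tor}_1^R(M,N)=0 \text{ for all } M\in \mathsf{FP}_n\text{-}\mathsf{Flat}(R^{op})\}.$$ \textbf{Theorem.}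 Let $R$ be a left Vogel-regular ring. Then the following are equivalent: (i) there is an integer $n\ge 2$ such that the class $[\mathsf{FP}_n\text{-}\mathsf{Flat}(R^{op})]^{\top_1}$ has the 2-out-of-3 property; (ii) $R$ is left coherent. -/

import Mathlib

open CategoryTheory CategoryTheory.Limits

open scoped TensorProduct

universe u

namespace VogelRegular

section Tensor

variable (R : Type u) [Ring R]

/-- The subgroup of `M ⊗ N` (tensor product of abelian groups) generated by the elements
`(m · r) ⊗ n - m ⊗ (r · n)`, where `M` is a right `R`-module, that is, a module over the opposite
ring `Rᵐᵒᵖ`, and `N` is a left `R`-module. -/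
def balancedRelations (M N : Type u) [AddCommGroup M] [Module Rᵐᵒᵖ M]
    [AddCommGroup N] [Module R N] : AddSubgroup (M ⊗[ℤ] N) :=
  AddSubgroup.closure
    {x | ∃ (m : M) (r : R) (n : N), x = (MulOpposite.op r • m) ⊗ₜ[ℤ] n - m ⊗ₜ[ℤ] (r • n)}

/-- The tensor product `M ⊗_R N` of a right module and a left module over a ring `R` that need
not be commutative, as an abelian group. -/
abbrev BalancedTensor (M N : Type u) [AddCommGroup M] [Module Rᵐᵒᵖ M]
    [AddCommGroup N] [Module R N] : Type u :=
  (M ⊗[ℤ] N) ⧸ balancedRelations R M N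

/-- The pure tensor `m ⊗ n` in `M ⊗_R N`. -/
def BalancedTensor.tmul {M N : Type u} [AddCommGroup M] [Module Rᵐᵒᵖ M]
    [AddCommGroup N] [Module R N] (m : M) (n : N) : BalancedTensor R M N :=
  QuotientAddGroup.mk' (balancedRelations R M N) (m ⊗ₜ[ℤ] n)

variable {R}

theorem BalancedTensor.hom_ext {M N : Type u} [AddCommGroup M] [Module Rᵐᵒᵖ M]
    [AddCommGroup N] [Module R N] {A : Type u} [AddCommGroup A]
    {g h : BalancedTensor R M N →+ A}
    (H : ∀ m n, g (BalancedTensor.tmul R m n) = h (BalancedTensor.tmul R m n)) : g = h := by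
  refine QuotientAddGroup.addMonoidHom_ext _ (AddMonoidHom.ext fun x => ?_)
  induction x using TensorProduct.induction_on with
  | zero => simp
  | tmul m n => exact H m n
  | add x y hx hy => rw [map_add, map_add, hx, hy]

/-- The map `M ⊗_R N → M ⊗_R N'`, `m ⊗ n ↦ m ⊗ f n`, induced by an `R`-linear map
`f : N → N'`. -/
def BalancedTensor.lTensor (M : Type u) {N N' : Type u} [AddCommGroup M] [Module Rᵐᵒᵖ M]
    [AddCommGroup N] [Module R N] [AddCommGroup N'] [Module R N'] (f : N →ₗ[R] N') :
    BalancedTensor R M N →+ BalancedTensor R M N' :=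
  QuotientAddGroup.map _ _
    (LinearMap.lTensor M f.toAddMonoidHom.toIntLinearMap).toAddMonoidHom (by
      rw [balancedRelations, AddSubgroup.closure_le]
      rintro _ ⟨m, r, n, rfl⟩
      refine AddSubgroup.subset_closure ⟨m, r, f n, ?_⟩
      simp)

theorem BalancedTensor.lTensor_tmul (M : Type u) {N N' : Type u} [AddCommGroup M]
    [Module Rᵐᵒᵖ M] [AddCommGroup N] [Module R N] [AddCommGroup N'] [Module R N']
    (f : N →ₗ[R] N') (m : M) (n : N) :
    BalancedTensor.lTensor M f (BalancedTensor.tmul R m n) = BalancedTensor.tmul R m (f n) := rfl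

/-- The functor `M ⊗_R -` from left `R`-modules to abelian groups. -/
noncomputable def tensorFunctor (M : ModuleCat.{u} Rᵐᵒᵖ) :
    ModuleCat.{u} R ⥤ AddCommGrpCat.{u} where
  obj N := AddCommGrpCat.of (BalancedTensor R M N)
  map f := AddCommGrpCat.ofHom (BalancedTensor.lTensor M f.hom)
  map_id N := by
    apply AddCommGrpCat.hom_ext
    exact BalancedTensor.hom_ext fun m n => rfl
  map_comp f g := by
    apply AddCommGrpCat.hom_ext
    exact BalancedTensor.hom_ext fun m n => rfl

instance tensorFunctor_additive (M : ModuleCat.{u} Rᵐᵒᵖ) : (tensorFunctor M).Additive where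
  map_add {N N' f g} := by
    apply AddCommGrpCat.hom_ext
    refine BalancedTensor.hom_ext fun m n => ?_
    change BalancedTensor.tmul R m (f.hom n + g.hom n) =
      BalancedTensor.tmul R m (f.hom n) + BalancedTensor.tmul R m (g.hom n)
    simp only [BalancedTensor.tmul, TensorProduct.tmul_add, map_add]

/-- `Tor_i^R(M, N)` for a right module `M` and a left module `N`: the `i`-th left derived functor
of `M ⊗_R -`, evaluated at `N`. -/
noncomputable def Tor (i : ℕ) (M : ModuleCat.{u} Rᵐᵒᵖ) (N : ModuleCat.{u} R) : AddCommGrpCat.{u} :=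
  ((tensorFunctor M).leftDerived i).obj N

end Tensor

section Classes

variable {R : Type u} [Ring R]

/-- `M` is finitely `n`-presented: there is an exact sequence
`F n → F (n - 1) → ⋯ → F 0 → M → 0` with `F i` finitely generated projective for `i ≤ n`.
(The modules `F i` and maps `d i` beyond this range are irrelevant.) -/
def IsFinitelyPresentedOfOrder (n : ℕ) (M : ModuleCat.{u} R) : Prop :=
  ∃ (F : ℕ → ModuleCat.{u} R) (d : ∀ i, F (i + 1) →ₗ[R] F i) (ε : F 0 →ₗ[R] M),
    (∀ i ≤ n, Module.Finite R (F i) ∧ Module.Projective R (F i)) ∧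
    Function.Surjective ε ∧
    (0 < n → Function.Exact (d 0) ε) ∧
    (∀ i, i + 1 < n → Function.Exact (d (i + 1)) (d i))

variable (R) in
/-- The class of `FP_n`-flat right `R`-modules: those `M` with `Tor_1^R(M, F) = 0` for every
finitely `n`-presented left `R`-module `F`. -/
def fpFlatRight (n : ℕ) : ObjectProperty (ModuleCat.{u} Rᵐᵒᵖ) := fun M =>
  ∀ F : ModuleCat.{u} R, IsFinitelyPresentedOfOrder n F → IsZero (Tor 1 M F)

/-- For a class `X` of right `R`-modules, the class of left `R`-modules `N` with
`Tor_1^R(M, N) = 0` for all `M` in `X`. -/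
def torOrthogonal (X : ObjectProperty (ModuleCat.{u} Rᵐᵒᵖ)) : ObjectProperty (ModuleCat.{u} R) :=
  fun N => ∀ M : ModuleCat.{u} Rᵐᵒᵖ, X M → IsZero (Tor 1 M N)

/-- The 2-out-of-3 property in the category of all left `R`-modules: if two of the three modules
in a short exact sequence belong to the class, then so does the third. -/
def HasTwoOutOfThree (C : ObjectProperty (ModuleCat.{u} R)) : Prop :=
  ∀ S : ShortComplex (ModuleCat.{u} R), S.ShortExact →
    (C S.X₁ → C S.X₂ → C S.X₃) ∧ (C S.X₁ → C S.X₃ → C S.X₂) ∧ (C S.X₂ → C S.X₃ → C S.X₁)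

/-- A class is closed under direct limits, that is, colimits indexed by nonempty directed
preordered sets. -/
def IsClosedUnderDirectLimits (C : ObjectProperty (ModuleCat.{u} R)) : Prop :=
  ∀ (J : Type u) [Preorder J] [IsDirectedOrder J] [Nonempty J],
    C.IsClosedUnderColimitsOfShape J

/-- Vogel classes of left `R`-modules. -/
structure IsVogelClass (C : ObjectProperty (ModuleCat.{u} R)) : Prop where
  directLimits : IsClosedUnderDirectLimits C
  twoOutOfThree : HasTwoOutOfThree C
  finiteProjective : ∀ P : ModuleCat.{u} R, Module.Finite R P → Module.Projective R P → C P

variable (R)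

/-- `R` is left Vogel-regular: the only Vogel class is the class of all left `R`-modules. -/
def IsLeftVogelRegular : Prop :=
  ∀ C : ObjectProperty (ModuleCat.{u} R), IsVogelClass C → C = ⊤

/-- `R` is left coherent: every finitely generated left ideal is finitely presented. -/
def IsLeftCoherent : Prop :=
  ∀ I : Ideal R, I.FG → Module.FinitePresentation R I

end Classes

end VogelRegular

/-! Tor commutes with direct limits, so every Tor-orthogonal class is closed under them and contains
the projectives; once it has the 2-out-of-3 property it is a Vogel class, and Vogel-regularity makes
it the class of all modules. Every FP_n-flat right module is then flat. For `n ≥ 2` the powers `R^ι`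
are FP_n-flat: the first syzygy `L` of a finitely `n`-presented module is finitely presented, so
`R^ι ⊗ L → L^ι` is injective (`piTensor_injective`, `fpFlatRight_pi`). Hence all powers of `R` are
flat, and Chase's argument (`isLeftCoherent_of_tor_pi`) gives coherence.

Conversely, over a left coherent ring every FP_2-flat module is flat
(`IsLeftCoherent.isZero_tor_one`), so for `n = 2` the orthogonal class is everything.

All Tor computations go through `isZero_tor_one_iff`, which turns vanishing of Tor₁ into injectivity
of `M ⊗ K → M ⊗ P` for one presentation with `P` projective. -/

namespace VogelRegular

variable {R : Type u} [Ring R]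

/-! ### Elementary properties of the balanced tensor product -/

namespace BalancedTensor

section Basic

variable {M N A : Type u} [AddCommGroup M] [Module Rᵐᵒᵖ M] [AddCommGroup N] [Module R N]
  [AddCommGroup A]

theorem tmul_add (m : M) (n n' : N) : tmul R m (n + n') = tmul R m n + tmul R m n' := by
  simp only [tmul, TensorProduct.tmul_add, map_add]

theorem add_tmul (m m' : M) (n : N) : tmul R (m + m') n = tmul R m n + tmul R m' n := by
  simp only [tmul, TensorProduct.add_tmul, map_add]

theorem op_smul_tmul (r : R) (m : M) (n : N) :
    tmul R (MulOpposite.op r • m) n = tmul R m (r • n) := by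
  refine QuotientAddGroup.eq.2 ?_
  rw [← neg_mem_iff]
  refine AddSubgroup.subset_closure ⟨m, r, n, ?_⟩
  abel

@[elab_as_elim]
theorem induction_on {p : BalancedTensor R M N → Prop} (x : BalancedTensor R M N)
    (zero : p 0) (tmul : ∀ m n, p (tmul R m n)) (add : ∀ x y, p x → p y → p (x + y)) : p x := by
  obtain ⟨x, rfl⟩ := QuotientAddGroup.mk'_surjective _ x
  induction x using TensorProduct.induction_on with
  | zero => simpa using zero
  | tmul m n => exact tmul m n
  | add x y hx hy => rw [map_add]; exact add _ _ hx hy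

/-- The homomorphism out of `M ⊗_R N` defined by a balanced biadditive map. -/
def lift (φ : M →+ N →+ A) (h : ∀ m (r : R) n, φ (MulOpposite.op r • m) n = φ m (r • n)) :
    BalancedTensor R M N →+ A :=
  QuotientAddGroup.lift _ (TensorProduct.liftAddHom φ fun z m n => by simp) (by
    rw [balancedRelations, AddSubgroup.closure_le]
    rintro _ ⟨m, r, n, rfl⟩
    simp [h])

variable (R) in
/-- The pure tensor as a biadditive map. -/
def mk (M N : Type u) [AddCommGroup M] [Module Rᵐᵒᵖ M] [AddCommGroup N] [Module R N] :
    M →+ N →+ BalancedTensor R M N :=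
  AddMonoidHom.mk' (fun m => AddMonoidHom.mk' (tmul R m) (tmul_add m))
    fun m m' => AddMonoidHom.ext fun n => add_tmul m m' n

theorem mk_apply (m : M) (n : N) : mk R M N m n = tmul R m n := rfl

end Basic

section LTensor

variable {M N N' N'' : Type u} [AddCommGroup M] [Module Rᵐᵒᵖ M] [AddCommGroup N] [Module R N]
  [AddCommGroup N'] [Module R N'] [AddCommGroup N''] [Module R N'']

theorem lTensor_comp_apply (g : N' →ₗ[R] N'') (f : N →ₗ[R] N') (x : BalancedTensor R M N) :
    lTensor M (g ∘ₗ f) x = lTensor M g (lTensor M f x) :=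
  DFunLike.congr_fun (hom_ext (g := lTensor M (g ∘ₗ f)) (h := (lTensor M g).comp (lTensor M f))
    fun _ _ => rfl) x

theorem lTensor_id_apply (x : BalancedTensor R M N) :
    lTensor M (LinearMap.id : N →ₗ[R] N) x = x :=
  DFunLike.congr_fun (hom_ext (g := lTensor M (LinearMap.id : N →ₗ[R] N))
    (h := AddMonoidHom.id _) fun _ _ => rfl) x

theorem lTensor_add_apply (f g : N →ₗ[R] N') (x : BalancedTensor R M N) :
    lTensor M (f + g) x = lTensor M f x + lTensor M g x :=
  DFunLike.congr_fun (hom_ext (g := lTensor M (f + g)) (h := lTensor M f + lTensor M g)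
    fun m n => tmul_add m (f n) (g n)) x

theorem lTensor_zero_apply (x : BalancedTensor R M N) :
    lTensor M (0 : N →ₗ[R] N') x = 0 :=
  DFunLike.congr_fun (hom_ext (g := lTensor M (0 : N →ₗ[R] N')) (h := 0)
    fun m _ => map_zero (mk R M N' m)) x

theorem lTensor_surjective {f : N →ₗ[R] N'} (hf : Function.Surjective f) :
    Function.Surjective (lTensor M f) := by
  intro x
  induction x using induction_on with
  | zero => exact ⟨0, map_zero _⟩
  | tmul m n => obtain ⟨n, rfl⟩ := hf n; exact ⟨tmul R m n, rfl⟩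
  | add x y hx hy =>
    obtain ⟨x, rfl⟩ := hx
    obtain ⟨y, rfl⟩ := hy
    exact ⟨x + y, map_add _ _ _⟩

theorem lTensor_injective_of_comp_eq_id {f : N →ₗ[R] N'} {g : N' →ₗ[R] N}
    (h : g ∘ₗ f = LinearMap.id) : Function.Injective (lTensor M f) :=
  Function.LeftInverse.injective (g := lTensor M g) fun x => by
    rw [← lTensor_comp_apply, h, lTensor_id_apply]

end LTensor

end BalancedTensor

/-! ### Tensor-hom adjunction and right exactness -/

section Adjunction

/-- The left `R`-module structure on `Hom(M, A)` coming from the right `R`-module `M`. -/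
abbrev homModule (M : ModuleCat.{u} Rᵐᵒᵖ) (A : Type u) [AddCommGroup A] :
    Module R (M →+ A) where
  smul r f := f.comp (DistribSMul.toAddMonoidHom M (MulOpposite.op r))
  one_smul f := AddMonoidHom.ext fun m => congrArg f (one_smul _ m)
  mul_smul r s f := AddMonoidHom.ext fun m =>
    congrArg f ((congrArg (· • m) (MulOpposite.op_mul r s)).trans (mul_smul _ _ m))
  smul_zero _ := rfl
  smul_add _ _ _ := rfl
  add_smul r s f := AddMonoidHom.ext fun m =>
    ((congrArg f (add_smul (MulOpposite.op r) (MulOpposite.op s) m)).trans (map_add f _ _))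
  zero_smul f := AddMonoidHom.ext fun m =>
    (congrArg f (zero_smul Rᵐᵒᵖ m)).trans (map_zero f)

/-- The functor `Hom(M, -)` from abelian groups to left `R`-modules. -/
def homFunctor (M : ModuleCat.{u} Rᵐᵒᵖ) : AddCommGrpCat.{u} ⥤ ModuleCat.{u} R where
  obj A := letI := homModule M A; ModuleCat.of R (M →+ A)
  map {A B} f :=
    letI := homModule M A
    letI := homModule M B
    ModuleCat.ofHom
      { toFun := fun g => f.hom.comp g
        map_add' := fun g h => AddMonoidHom.ext fun m => map_add f.hom (g m) (h m)
        map_smul' := fun _ _ => rfl }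

/-- `M ⊗_R -` is left adjoint to `Hom(M, -)`. -/
noncomputable def tensorHomAdjunction (M : ModuleCat.{u} Rᵐᵒᵖ) :
    tensorFunctor M ⊣ homFunctor M :=
  Adjunction.mkOfHomEquiv
    { homEquiv := fun N A =>
        letI := homModule M A
        { toFun := fun f => ModuleCat.ofHom (Y := M →+ A)
            { toFun := fun n => f.hom.comp ((BalancedTensor.mk R M N).flip n)
              map_add' := fun n n' => AddMonoidHom.ext fun m =>
                (congrArg f.hom (BalancedTensor.tmul_add m n n')).trans (map_add f.hom _ _)
              map_smul' := fun r n => AddMonoidHom.ext fun m =>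
                congrArg f.hom (BalancedTensor.op_smul_tmul r m n).symm }
          invFun := fun g =>
            let g' : N →ₗ[R] (M →+ A) := g.hom
            AddCommGrpCat.ofHom (BalancedTensor.lift g'.toAddMonoidHom.flip
              fun m r n => (DFunLike.congr_fun (map_smul g' r n) m).symm)
          left_inv := fun f => by
            apply AddCommGrpCat.hom_ext
            exact BalancedTensor.hom_ext fun _ _ => rfl
          right_inv := fun g => rfl }
      homEquiv_naturality_left_symm := fun f g => by
        apply AddCommGrpCat.hom_ext
        exact BalancedTensor.hom_ext fun _ _ => rfl
      homEquiv_naturality_right := fun f g => rfl }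

instance (M : ModuleCat.{u} Rᵐᵒᵖ) : (tensorFunctor M).IsLeftAdjoint :=
  (tensorHomAdjunction M).isLeftAdjoint

/-- A left adjoint preserves cokernels, which is right exactness. -/
theorem BalancedTensor.lTensor_exact (M : ModuleCat.{u} Rᵐᵒᵖ) {K P N : Type u} [AddCommGroup K]
    [Module R K] [AddCommGroup P] [Module R P] [AddCommGroup N] [Module R N] {f : K →ₗ[R] P}
    {g : P →ₗ[R] N} (h : Function.Exact f g) (hg : Function.Surjective g) :
    Function.Exact (BalancedTensor.lTensor M f) (BalancedTensor.lTensor M g) := by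
  let S : ShortComplex (ModuleCat.{u} R) :=
    ShortComplex.mk (ModuleCat.ofHom f) (ModuleCat.ofHom g)
      (ModuleCat.hom_ext h.linearMap_comp_eq_zero)
  have hS : S.Exact := (ShortComplex.moduleCat_exact_iff _).2 fun x hx => (h x).1 hx
  have : Epi S.g := (ModuleCat.epi_iff_surjective _).2 hg
  have := hS.map_of_epi_of_preservesCokernel (tensorFunctor M) ‹_› inferInstance
  exact (ShortComplex.ab_exact_iff_function_exact _).1 this

end Adjunction

/-! ### Tor₁ through projective presentations -/

section Presentation

variable {K P N : Type u} [AddCommGroup K] [Module R K] [AddCommGroup P] [Module R P]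
  [AddCommGroup N] [Module R N]

theorem exists_comp_eq_of_exact {j : K →ₗ[R] P} {f : P →ₗ[R] N} (hj : Function.Injective j)
    (h : Function.Exact j f) {A : Type u} [AddCommGroup A] [Module R A] (g : A →ₗ[R] P)
    (hg : ∀ a, f (g a) = 0) : ∃ k : A →ₗ[R] K, ∀ a, j (k a) = g a := by
  refine ⟨(LinearEquiv.ofInjective j hj).symm ∘ₗ
    g.codRestrict (LinearMap.range j) fun a => (h _).1 (hg a), fun a => ?_⟩
  exact congrArg Subtype.val ((LinearEquiv.ofInjective j hj).apply_symm_apply _)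

/-- Comparison of presentations as in Schanuel's lemma. Lifting the identity of `N` gives `a : P →
P'` and `b : P' → P`, with restrictions `k`, `k'` to the kernels; `b ∘ a - id` factors through `j`
by some `s`, so `k' ∘ k = id + s ∘ j`. An `x` killed by `M ⊗ j` is killed by `M ⊗ k`, since `M ⊗ j'`
is injective, and then the identity forces `x = 0`. -/
theorem lTensor_injective_of_projective {K' P' : Type u} [AddCommGroup K'] [Module R K']
    [AddCommGroup P'] [Module R P'] [Module.Projective R P] [Module.Projective R P']
    {j : K →ₗ[R] P} {f : P →ₗ[R] N} (hj : Function.Injective j) (h : Function.Exact j f)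
    (hf : Function.Surjective f) {j' : K' →ₗ[R] P'} {f' : P' →ₗ[R] N}
    (hj' : Function.Injective j') (h' : Function.Exact j' f') (hf' : Function.Surjective f')
    (M : Type u) [AddCommGroup M] [Module Rᵐᵒᵖ M]
    (H : Function.Injective (BalancedTensor.lTensor M j')) :
    Function.Injective (BalancedTensor.lTensor M j) := by
  obtain ⟨a, ha⟩ := Module.projective_lifting_property f' f hf'
  obtain ⟨b, hb⟩ := Module.projective_lifting_property f f' hf
  replace ha : ∀ x, f' (a x) = f x := LinearMap.congr_fun ha
  replace hb : ∀ x, f (b x) = f' x := LinearMap.congr_fun hb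
  obtain ⟨k, hk⟩ := exists_comp_eq_of_exact hj' h' (a ∘ₗ j) fun x => by
    simp [ha, h.apply_apply_eq_zero]
  obtain ⟨k', hk'⟩ := exists_comp_eq_of_exact hj h (b ∘ₗ j') fun x => by
    simp [hb, h'.apply_apply_eq_zero]
  obtain ⟨s, hs⟩ := exists_comp_eq_of_exact hj h (b ∘ₗ a - LinearMap.id) fun x => by
    simp [ha, hb]
  have key : k' ∘ₗ k = LinearMap.id + s ∘ₗ j := by
    ext x
    apply hj
    simp [hk', hk, hs]
  have key' : j' ∘ₗ k = a ∘ₗ j := LinearMap.ext hk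
  rw [injective_iff_map_eq_zero]
  intro x hx
  have h₁ : BalancedTensor.lTensor M k x = 0 := by
    apply H
    rw [← BalancedTensor.lTensor_comp_apply, key', BalancedTensor.lTensor_comp_apply, hx, map_zero,
      map_zero]
  have h₂ := BalancedTensor.lTensor_comp_apply (M := M) k' k x
  rw [key, h₁, map_zero, BalancedTensor.lTensor_add_apply, BalancedTensor.lTensor_comp_apply, hx,
    map_zero, add_zero, BalancedTensor.lTensor_id_apply] at h₂
  exact h₂

/-- The map `d₁` is a surjection `e` onto `ker f` followed by the inclusion. Right exactness already
gives exactness of `M ⊗ d₂`, `M ⊗ e`, so only the inclusion can fail. -/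
theorem lTensor_exact_iff_injective (M : ModuleCat.{u} Rᵐᵒᵖ) {A B : Type u} [AddCommGroup A]
    [Module R A] [AddCommGroup B] [Module R B] {d₂ : A →ₗ[R] B} {d₁ : B →ₗ[R] P} {f : P →ₗ[R] N}
    (h₂ : Function.Exact d₂ d₁) (h₁ : Function.Exact d₁ f) :
    Function.Exact (BalancedTensor.lTensor M d₂) (BalancedTensor.lTensor M d₁) ↔
      Function.Injective (BalancedTensor.lTensor M (LinearMap.ker f).subtype) := by
  let e : B →ₗ[R] LinearMap.ker f := d₁.codRestrict _ h₁.apply_apply_eq_zero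
  have he : Function.Surjective e := fun ⟨x, hx⟩ => by
    obtain ⟨y, rfl⟩ := (h₁ x).1 hx
    exact ⟨y, rfl⟩
  have hd : d₁ = (LinearMap.ker f).subtype ∘ₗ e := rfl
  have h₂e : Function.Exact d₂ e := fun y => by
    rw [← h₂ y, Subtype.ext_iff]
    rfl
  have H := BalancedTensor.lTensor_exact M h₂e he
  have hcomp := BalancedTensor.lTensor_comp_apply (M := M) (LinearMap.ker f).subtype e
  rw [hd]
  constructor
  · intro hex
    rw [injective_iff_map_eq_zero]
    intro x hx
    obtain ⟨y, rfl⟩ := BalancedTensor.lTensor_surjective he x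
    rw [← hcomp] at hx
    exact (H y).2 ((hex y).1 hx)
  · intro hinj y
    rw [hcomp, ← H y, map_eq_zero_iff _ hinj]

end Presentation

/-- `Tor₁(M, N)` vanishes if and only if `M ⊗ -` preserves the injectivity of the kernel of a
projective presentation of `N`. -/
theorem isZero_tor_one_iff (M : ModuleCat.{u} Rᵐᵒᵖ) (N : ModuleCat.{u} R) {K P : Type u}
    [AddCommGroup K] [Module R K] [AddCommGroup P] [Module R P] [Module.Projective R P]
    {j : K →ₗ[R] P} {f : P →ₗ[R] N} (hj : Function.Injective j) (h : Function.Exact j f)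
    (hf : Function.Surjective f) :
    IsZero (Tor 1 M N) ↔ Function.Injective (BalancedTensor.lTensor M j) := by
  let Q : ProjectiveResolution N := ProjectiveResolution.of N
  let π : Q.complex.X 0 →ₗ[R] N := (Q.π.f 0).hom
  have hπ : Function.Surjective π := (ModuleCat.epi_iff_surjective (Q.π.f 0)).1 inferInstance
  have : Module.Projective R (Q.complex.X 0) :=
    (IsProjective.iff_projective _).2 (Q.projective 0)
  have h₁ : Function.Exact (Q.complex.d 1 0).hom π :=
    (ShortComplex.ShortExact.moduleCat_exact_iff_function_exact _).1 Q.exact₀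
  have h₂ : Function.Exact (Q.complex.d 2 1).hom (Q.complex.d 1 0).hom :=
    (ShortComplex.ShortExact.moduleCat_exact_iff_function_exact _).1 (Q.exact_succ 0)
  have e : IsZero (Tor 1 M N) ↔
      Function.Exact (BalancedTensor.lTensor M (Q.complex.d 2 1).hom)
        (BalancedTensor.lTensor M (Q.complex.d 1 0).hom) := by
    rw [Tor, (Q.isoLeftDerivedObj (tensorFunctor M) 1).isZero_iff]
    refine (HomologicalComplex.exactAt_iff_isZero_homology _ _).symm.trans ?_
    rw [HomologicalComplex.exactAt_iff' _ 2 1 0 (by simp) (by simp),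
      ShortComplex.ab_exact_iff_function_exact]
    rfl
  -- The resolution yields one presentation of `N`; the comparison lemma transfers injectivity
  -- between it and the given one.
  rw [e, lTensor_exact_iff_injective M h₂ h₁]
  have hK : Function.Exact (LinearMap.ker π).subtype π := LinearMap.exact_subtype_ker_map π
  exact ⟨lTensor_injective_of_projective hj h hf (Submodule.injective_subtype _) hK hπ M,
    lTensor_injective_of_projective (Submodule.injective_subtype _) hK hπ hj h hf M⟩

theorem torOrthogonal_of_projective (X : ObjectProperty (ModuleCat.{u} Rᵐᵒᵖ)) (P : ModuleCat.{u} R)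
    [Module.Projective R P] : torOrthogonal X P := by
  have : Projective P := (IsProjective.iff_projective P).1 inferInstance
  exact fun M _ => (tensorFunctor M).isZero_leftDerived_obj_projective_succ 0 P

/-! ### Tor₁ and direct limits -/

section DirectLimits

/-- The canonical map from the free module on the underlying set of `N` to `N`. -/
noncomputable def freeCover (N : ModuleCat.{u} R) :
    (ModuleCat.free R).obj ((forget (ModuleCat.{u} R)).obj N) →ₗ[R] N :=
  ((ModuleCat.adj R).counit.app N).hom

theorem freeCover_surjective (N : ModuleCat.{u} R) : Function.Surjective (freeCover N) :=
  (ModuleCat.epi_iff_surjective ((ModuleCat.adj R).counit.app N)).1 inferInstance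

instance (X : Type u) : Module.Projective R ((ModuleCat.free R).obj X) :=
  inferInstanceAs (Module.Projective R (X →₀ R))

/-- The kernel of the canonical map from the free module on the underlying set of `N` to `N`. -/
noncomputable abbrev freeKernel (N : ModuleCat.{u} R) : Submodule R
    ((ModuleCat.free R).obj ((forget (ModuleCat.{u} R)).obj N)) :=
  LinearMap.ker (freeCover N)

/-- This presentation is functorial in `N`, which is what allows passage to a direct limit. -/
theorem isZero_tor_one_iff_freeKernel (M : ModuleCat.{u} Rᵐᵒᵖ) (N : ModuleCat.{u} R) :
    IsZero (Tor 1 M N) ↔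
      Function.Injective (BalancedTensor.lTensor M (freeKernel N).subtype) :=
  isZero_tor_one_iff M N (Submodule.injective_subtype _) (LinearMap.exact_subtype_ker_map _)
    (freeCover_surjective N)

section FreeKernelMap

variable {N N' N'' : ModuleCat.{u} R}

/-- The map between the canonical free modules induced by a linear map. -/
noncomputable def freeMap (f : N ⟶ N') :
    (ModuleCat.free R).obj ((forget (ModuleCat.{u} R)).obj N) →ₗ[R]
      (ModuleCat.free R).obj ((forget (ModuleCat.{u} R)).obj N') :=
  ((forget (ModuleCat.{u} R) ⋙ ModuleCat.free R).map f).hom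

theorem freeMap_comp (f : N ⟶ N') (g : N' ⟶ N'') : freeMap (f ≫ g) = freeMap g ∘ₗ freeMap f :=
  congrArg ModuleCat.Hom.hom ((forget (ModuleCat.{u} R) ⋙ ModuleCat.free R).map_comp f g)

theorem freeCover_freeMap (f : N ⟶ N')
    (x : (ModuleCat.free R).obj ((forget (ModuleCat.{u} R)).obj N)) :
    freeCover N' (freeMap f x) = f.hom (freeCover N x) :=
  LinearMap.congr_fun (congrArg ModuleCat.Hom.hom ((ModuleCat.adj R).counit.naturality f)) x

/-- The map between the canonical kernels induced by a linear map. -/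
noncomputable def freeKernelMap (f : N ⟶ N') : freeKernel N →ₗ[R] freeKernel N' :=
  (freeMap f).restrict fun x hx => by
    rw [LinearMap.mem_ker, freeCover_freeMap, LinearMap.mem_ker.1 hx, map_zero]

theorem subtype_comp_freeKernelMap (f : N ⟶ N') :
    (freeKernel N').subtype ∘ₗ freeKernelMap f = freeMap f ∘ₗ (freeKernel N).subtype := rfl

theorem freeKernelMap_comp (f : N ⟶ N') (g : N' ⟶ N'') :
    freeKernelMap (f ≫ g) = freeKernelMap g ∘ₗ freeKernelMap f :=
  LinearMap.ext fun x => Subtype.ext (LinearMap.congr_fun (freeMap_comp f g) x.1)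

end FreeKernelMap

section Cocone

variable {J : Type u} [Preorder J] {D : J ⥤ ModuleCat.{u} R} {c : Cocone D}

/-- The morphism to the point of a cocone, with its target in reduced form. -/
abbrev coconeMap (c : Cocone D) (j : J) : D.obj j ⟶ c.pt := c.ι.app j

theorem lTensor_freeKernelMap_coconeMap (M : ModuleCat.{u} Rᵐᵒᵖ) {i j : J} (f : i ⟶ j)
    (y : BalancedTensor R M (freeKernel (D.obj i))) :
    BalancedTensor.lTensor M (freeKernelMap (coconeMap c j))
        (BalancedTensor.lTensor M (freeKernelMap (D.map f)) y) =
      BalancedTensor.lTensor M (freeKernelMap (coconeMap c i)) y := by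
  rw [← BalancedTensor.lTensor_comp_apply, ← freeKernelMap_comp, coconeMap, c.w]

variable [IsDirectedOrder J] [Nonempty J]

theorem exists_freeKernelMap_eq (hc : IsColimit c) (x : freeKernel c.pt) :
    ∃ (j : J) (y : freeKernel (D.obj j)), freeKernelMap (coconeMap c j) y = x := by
  have hF : IsColimit ((forget (ModuleCat.{u} R) ⋙ ModuleCat.free R).mapCocone c) :=
    have : PreservesColimits (ModuleCat.free R) := (ModuleCat.adj R).leftAdjoint_preservesColimits
    isColimitOfPreserves _ hc
  obtain ⟨i, y, hy⟩ := Concrete.isColimit_exists_rep _ hF x.1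
  replace hy : freeMap (coconeMap c i) y = x.1 := hy
  have hx : (coconeMap c i).hom (freeCover _ y) = 0 := by
    rw [← freeCover_freeMap, hy]
    exact x.2
  -- The representative `y` need not lie in the kernel at stage `i`, but its image in `D.obj i` dies
  -- in the colimit, hence already at some stage `k`.
  obtain ⟨k, f, g, hfg⟩ := Concrete.isColimit_exists_of_rep_eq D hc
    (freeCover _ y) (0 : D.obj i) (hx.trans (map_zero (coconeMap c i).hom).symm)
  have hfg' : (D.map f).hom (freeCover _ y) = 0 := hfg.trans (map_zero (D.map g).hom)
  refine ⟨k, ⟨freeMap (D.map f) y, ?_⟩, Subtype.ext ?_⟩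
  · rw [LinearMap.mem_ker, freeCover_freeMap, hfg']
  · have hw : coconeMap c i = D.map f ≫ coconeMap c k := (c.w f).symm
    rw [← hy, hw, freeMap_comp]
    rfl

theorem exists_lTensor_freeKernelMap_eq (hc : IsColimit c) (M : ModuleCat.{u} Rᵐᵒᵖ)
    (x : BalancedTensor R M (freeKernel c.pt)) :
    ∃ (j : J) (y : BalancedTensor R M (freeKernel (D.obj j))),
      BalancedTensor.lTensor M (freeKernelMap (coconeMap c j)) y = x := by
  induction x using BalancedTensor.induction_on with
  | zero => exact ⟨Classical.arbitrary J, 0, map_zero _⟩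
  | tmul m n =>
    obtain ⟨j, y, rfl⟩ := exists_freeKernelMap_eq hc n
    exact ⟨j, BalancedTensor.tmul R m y, rfl⟩
  | add x x' hx hx' =>
    obtain ⟨i, y, rfl⟩ := hx
    obtain ⟨j, y', rfl⟩ := hx'
    obtain ⟨k, hik, hjk⟩ := exists_ge_ge i j
    refine ⟨k, BalancedTensor.lTensor M (freeKernelMap (D.map (homOfLE hik))) y +
      BalancedTensor.lTensor M (freeKernelMap (D.map (homOfLE hjk))) y', ?_⟩
    rw [map_add, lTensor_freeKernelMap_coconeMap, lTensor_freeKernelMap_coconeMap]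

/-- Both the free covers and their tensor products with `M` commute with directed colimits. An
element killed in the limit comes from some stage, its image in the tensored free module dies at a
later stage `k`, and injectivity at stage `k` kills the element itself. -/
theorem isZero_tor_one_of_isColimit (hc : IsColimit c) (M : ModuleCat.{u} Rᵐᵒᵖ)
    (h : ∀ j, IsZero (Tor 1 M (D.obj j))) : IsZero (Tor 1 M c.pt) := by
  simp only [isZero_tor_one_iff_freeKernel] at h ⊢
  have hF : IsColimit
      ((forget (ModuleCat.{u} R) ⋙ ModuleCat.free R ⋙ tensorFunctor M).mapCocone c) :=
    have : PreservesColimits (ModuleCat.free R) := (ModuleCat.adj R).leftAdjoint_preservesColimits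
    isColimitOfPreserves _ hc
  rw [injective_iff_map_eq_zero]
  intro x hx
  obtain ⟨i, y, rfl⟩ := exists_lTensor_freeKernelMap_eq hc M x
  rw [← BalancedTensor.lTensor_comp_apply, subtype_comp_freeKernelMap,
    BalancedTensor.lTensor_comp_apply] at hx
  obtain ⟨k, f, g, hfg⟩ := Concrete.isColimit_exists_of_rep_eq _ hF (i := i) (j := i)
    (BalancedTensor.lTensor M (freeKernel (D.obj i)).subtype y)
    (0 : BalancedTensor R M ((ModuleCat.free R).obj ((forget (ModuleCat.{u} R)).obj (D.obj i))))
    (hx.trans (map_zero (BalancedTensor.lTensor M (freeMap (coconeMap c i)))).symm)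
  have hfg' : BalancedTensor.lTensor M (freeMap (D.map f))
      (BalancedTensor.lTensor M (freeKernel (D.obj i)).subtype y) = 0 :=
    hfg.trans (map_zero (BalancedTensor.lTensor M (freeMap (D.map g))))
  rw [← BalancedTensor.lTensor_comp_apply, ← subtype_comp_freeKernelMap,
    BalancedTensor.lTensor_comp_apply, map_eq_zero_iff _ (h k)] at hfg'
  rw [← lTensor_freeKernelMap_coconeMap M f y, hfg', map_zero]

end Cocone

theorem isClosedUnderDirectLimits_torOrthogonal (X : ObjectProperty (ModuleCat.{u} Rᵐᵒᵖ)) :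
    IsClosedUnderDirectLimits (torOrthogonal (R := R) X) := fun _ _ _ _ =>
  ⟨fun _ ⟨p⟩ M hM => isZero_tor_one_of_isColimit p.isColimit M fun j => p.prop_diag_obj j M hM⟩

theorem isVogelClass_torOrthogonal {X : ObjectProperty (ModuleCat.{u} Rᵐᵒᵖ)}
    (h : HasTwoOutOfThree (torOrthogonal (R := R) X)) :
    IsVogelClass (torOrthogonal (R := R) X) where
  directLimits := isClosedUnderDirectLimits_torOrthogonal X
  twoOutOfThree := h
  finiteProjective P _ _ := torOrthogonal_of_projective X P

end DirectLimits

/-! ### Powers of `R` and Chase's theorem -/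

section Products

variable (R) in
/-- The canonical map `R^ι ⊗_R L → L^ι`. -/
def piTensor (ι L : Type u) [AddCommGroup L] [Module R L] :
    BalancedTensor R (ι → R) L →+ (ι → L) :=
  BalancedTensor.lift
    (AddMonoidHom.mk' (fun x => AddMonoidHom.mk' (fun l i => x i • l)
      fun l l' => funext fun i => smul_add (x i) l l')
      fun x x' => AddMonoidHom.ext fun l => funext fun i => add_smul (x i) (x' i) l)
    fun x r l => funext fun i => mul_smul (x i) r l

variable {ι L L' : Type u} [AddCommGroup L] [Module R L] [AddCommGroup L'] [Module R L']

@[simp]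
theorem piTensor_tmul (x : ι → R) (l : L) (i : ι) :
    piTensor R ι L (BalancedTensor.tmul R x l) i = x i • l := rfl

theorem piTensor_lTensor (f : L →ₗ[R] L') (x : BalancedTensor R (ι → R) L) (i : ι) :
    piTensor R ι L' (BalancedTensor.lTensor (ι → R) f x) i = f (piTensor R ι L x i) := by
  induction x using BalancedTensor.induction_on with
  | zero => simp
  | tmul m n => simp [BalancedTensor.lTensor_tmul]
  | add x y hx hy => simp [hx, hy]

/-- A tensor is a finite sum of pure tensors, whose second factors generate `Q`. In Chase's theorem
this produces finite generation. -/
theorem exists_fg_piTensor_mem (x : BalancedTensor R (ι → R) L) :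
    ∃ Q : Submodule R L, Q.FG ∧ ∀ i, piTensor R ι L x i ∈ Q := by
  induction x using BalancedTensor.induction_on with
  | zero => exact ⟨⊥, Submodule.fg_bot, by simp⟩
  | tmul m n =>
    exact ⟨R ∙ n, Submodule.fg_span_singleton n, fun i =>
      Submodule.smul_mem _ _ (Submodule.mem_span_singleton_self n)⟩
  | add x y hx hy =>
    obtain ⟨Q, hQ, hx⟩ := hx
    obtain ⟨Q', hQ', hy⟩ := hy
    exact ⟨Q ⊔ Q', hQ.sup hQ', fun i => by
      rw [map_add]
      exact Submodule.add_mem_sup (hx i) (hy i)⟩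

theorem piTensor_surjective [Module.Finite R L] : Function.Surjective (piTensor R ι L) := by
  intro l
  obtain ⟨n, f, hf⟩ := Module.Finite.exists_fin' R L
  choose a ha using fun i => hf (l i)
  refine ⟨∑ j, BalancedTensor.tmul R (fun i => a i j) (f (Pi.single j 1)), funext fun i => ?_⟩
  rw [map_sum, Finset.sum_apply, ← ha i]
  simp only [piTensor_tmul, ← map_smul, ← map_sum]
  congr 1
  ext k
  simp [Pi.single_apply]

/-- A tensor over `R^n` can be rebuilt from its image by expanding in the standard basis. -/
theorem piTensor_fin_injective (n : ℕ) :
    Function.Injective (piTensor R ι (Fin n → R)) := by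
  have key (x : BalancedTensor R (ι → R) (Fin n → R)) :
      x = ∑ j, BalancedTensor.tmul R (fun i => piTensor R ι (Fin n → R) x i j)
        (Pi.single j (1 : R)) := by
    induction x using BalancedTensor.induction_on with
    | zero => exact (Finset.sum_eq_zero fun j _ =>
        DFunLike.congr_fun (map_zero (BalancedTensor.mk R (ι → R) (Fin n → R))) _).symm
    | tmul m v =>
      have hv : v = ∑ j, v j • Pi.single j (1 : R) := by
        ext k
        simp [Pi.single_apply]
      conv_lhs => rw [hv, ← BalancedTensor.mk_apply, map_sum]
      refine Finset.sum_congr rfl fun j _ => ?_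
      rw [BalancedTensor.mk_apply, ← BalancedTensor.op_smul_tmul]
      rfl
    | add x y hx hy =>
      conv_lhs => rw [hx, hy, ← Finset.sum_add_distrib]
      refine Finset.sum_congr rfl fun j _ => ?_
      rw [← BalancedTensor.add_tmul, map_add]
      rfl
  rw [injective_iff_map_eq_zero]
  intro x hx
  rw [key x, hx]
  exact Finset.sum_eq_zero fun j _ =>
    DFunLike.congr_fun (map_zero (BalancedTensor.mk R (ι → R) (Fin n → R))) _

/-- Chase through `ker f → R^n → L`: a lift `y` of `x` has all coordinates in `ker f`. As `ker f` is
finitely generated, that family comes from a tensor over `ker f`, which equals `y` by injectivity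
for `R^n`; so `y` maps to zero. -/
theorem piTensor_injective [Module.FinitePresentation R L] :
    Function.Injective (piTensor R ι L) := by
  obtain ⟨n, f, hf⟩ := Module.Finite.exists_fin' R L
  have : Module.Finite R (LinearMap.ker f) :=
    Module.Finite.iff_fg.2 (Module.FinitePresentation.fg_ker f hf)
  rw [injective_iff_map_eq_zero]
  intro x hx
  obtain ⟨y, rfl⟩ := BalancedTensor.lTensor_surjective (M := ι → R) hf x
  have hy (i) : f (piTensor R ι _ y i) = 0 := by
    rw [← piTensor_lTensor, hx]
    rfl
  obtain ⟨z, hz⟩ := piTensor_surjective (R := R) (ι := ι) (L := LinearMap.ker f)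
    fun i => ⟨piTensor R ι _ y i, hy i⟩
  have : y = BalancedTensor.lTensor (ι → R) (LinearMap.ker f).subtype z := by
    refine piTensor_fin_injective n (funext fun i => ?_)
    rw [piTensor_lTensor, hz]
    rfl
  rw [this, ← BalancedTensor.lTensor_comp_apply, LinearMap.comp_ker_subtype,
    BalancedTensor.lTensor_zero_apply]

variable (R ι) in
/-- Powers of `R` are `FP_n`-flat for `n ≥ 2`. -/
theorem fpFlatRight_pi {n : ℕ} (hn : 2 ≤ n) : fpFlatRight R n (ModuleCat.of Rᵐᵒᵖ (ι → R)) := by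
  rintro F ⟨P, d, ε, hP, hε, h₀, h₁⟩
  obtain ⟨_, _⟩ := hP 0 (by lia)
  obtain ⟨_, _⟩ := hP 1 (by lia)
  obtain ⟨_, _⟩ := hP 2 (by lia)
  replace h₀ := h₀ (by lia)
  replace h₁ := h₁ 0 (by lia)
  let e : P 1 →ₗ[R] LinearMap.ker ε := (d 0).codRestrict _ h₀.apply_apply_eq_zero
  have he : Function.Surjective e := fun ⟨x, hx⟩ => by
    obtain ⟨y, rfl⟩ := (h₀ x).1 hx
    exact ⟨y, rfl⟩
  -- The term `P 2`, available because `n ≥ 2`, makes the kernel of `P 1 → ker ε` finitely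
  -- generated, so `ker ε` is finitely presented.
  have hker : LinearMap.ker e = LinearMap.range (d 1) := by
    refine (LinearMap.ker_codRestrict _ _ _).trans ?_
    exact h₁.linearMap_ker_eq
  have : Module.FinitePresentation R (P 1) := Module.finitePresentation_of_projective R (P 1)
  have : Module.FinitePresentation R (LinearMap.ker ε) :=
    Module.finitePresentation_of_surjective e he (by
      rw [hker, LinearMap.range_eq_map]
      exact Module.Finite.fg_top.map _)
  rw [isZero_tor_one_iff _ _ (Submodule.injective_subtype _) (LinearMap.exact_subtype_ker_map ε) hε]
  rw [injective_iff_map_eq_zero]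
  intro x hx
  -- It suffices that the coordinates vanish in `ker ε`, and these can be read off in `P 0`.
  refine piTensor_injective (funext fun i => Subtype.ext ?_) (a₂ := 0)
  have := piTensor_lTensor (LinearMap.ker ε).subtype x i
  rw [hx] at this
  exact this.symm.trans (by simp)

/-- Chase's theorem: if all powers of `R` are flat right modules, then `R` is left coherent. -/
theorem isLeftCoherent_of_tor_pi
    (h : ∀ (ι : Type u) (N : ModuleCat.{u} R), IsZero (Tor 1 (ModuleCat.of Rᵐᵒᵖ (ι → R)) N)) :
    IsLeftCoherent R := by
  intro I hI
  have : Module.Finite R I := Module.Finite.iff_fg.2 hI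
  obtain ⟨n, p, hp⟩ := Module.Finite.exists_fin' R I
  refine Module.finitePresentation_of_surjective p hp ?_
  let Q := LinearMap.ker p
  have hQ : Function.Exact Q.subtype p := LinearMap.exact_subtype_ker_map p
  have hinj := (isZero_tor_one_iff (ModuleCat.of Rᵐᵒᵖ (Q → R)) (ModuleCat.of R (R ⧸ I))
    (Submodule.injective_subtype I) (f := I.mkQ) (LinearMap.exact_subtype_mkQ I)
    I.mkQ_surjective).1 (h Q _)
  -- Indexing by `Q` itself gives the tautological family, whose `k`-th coordinate is `k`.
  obtain ⟨x, hx⟩ := piTensor_surjective (R := R) (ι := Q) (fun k : Q => (k : Fin n → R))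
  have hx₀ : BalancedTensor.lTensor (Q → R) p x = 0 := by
    apply hinj
    rw [map_zero]
    refine piTensor_injective (R := R) (ι := Q) (L := R) (funext fun k => ?_)
    rw [map_zero]
    refine (piTensor_lTensor I.subtype _ k).trans ?_
    rw [piTensor_lTensor, hx]
    simp [LinearMap.mem_ker.1 k.2]
  -- Right exactness lifts `x` to a tensor over `Q`. Its coordinates run through all of `Q` yet lie
  -- in a finitely generated submodule, so `Q` is finitely generated.
  obtain ⟨z, rfl⟩ :=
    (BalancedTensor.lTensor_exact (ModuleCat.of Rᵐᵒᵖ (Q → R)) hQ hp x).1 hx₀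
  obtain ⟨S, hS, hzS⟩ := exists_fg_piTensor_mem z
  have hz (k : Q) : piTensor R Q Q z k = k :=
    Subtype.ext ((piTensor_lTensor Q.subtype z k).symm.trans (congrFun hx k))
  have hST : S = ⊤ := eq_top_iff.2 fun k _ => hz k ▸ hzS k
  exact (Module.Finite.iff_fg).1 ⟨hST ▸ hS⟩

end Products

/-! ### Flatness over a coherent ring -/

section Coherent

/-- Induction on `n`: the first coordinate maps `K` onto a finitely generated ideal, which is
finitely presented by coherence, so the kernel is finitely generated and embeds in `R^n`. An
extension of finitely presented modules is finitely presented. -/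
theorem IsLeftCoherent.finitePresentation_of_fg (hR : IsLeftCoherent R) :
    ∀ (n : ℕ) (K : Submodule R (Fin n → R)), K.FG → Module.FinitePresentation R K := by
  intro n
  induction n with
  | zero =>
    intro K hK
    have : Module.Finite R K := Module.Finite.iff_fg.2 hK
    exact Module.finitePresentation_of_projective R K
  | succ n ih =>
    intro K hK
    have : Module.Finite R K := Module.Finite.iff_fg.2 hK
    let π : (Fin (n + 1) → R) →ₗ[R] R := LinearMap.proj 0
    let τ : (Fin (n + 1) → R) →ₗ[R] (Fin n → R) := LinearMap.funLeft R R Fin.succ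
    have hI : (K.map π).FG := hK.map π
    have : Module.FinitePresentation R (K.map π) := hR _ hI
    let l : K →ₗ[R] K.map π := π.submoduleMap K
    have hl : Function.Surjective l := π.submoduleMap_surjective K
    have hker : (LinearMap.ker l).FG := Module.FinitePresentation.fg_ker l hl
    let t : LinearMap.ker l →ₗ[R] (Fin n → R) := τ ∘ₗ K.subtype ∘ₗ (LinearMap.ker l).subtype
    have ht : Function.Injective t := by
      rw [injective_iff_map_eq_zero]
      intro x hx
      apply Subtype.ext
      apply Subtype.ext
      funext i
      refine Fin.cases ?_ (fun i => ?_) i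
      · exact congrArg Subtype.val (LinearMap.mem_ker.1 x.2)
      · exact congrFun hx i
    have : Module.FinitePresentation R (LinearMap.range t) :=
      ih _ (by
        rw [LinearMap.range_eq_map]
        exact (Module.Finite.iff_fg.2 hker).fg_top.map _)
    let e : LinearMap.range t ≃ₗ[R] LinearMap.ker l := (LinearEquiv.ofInjective t ht).symm
    have : Module.FinitePresentation R (LinearMap.ker l) :=
      Module.FinitePresentation.of_equiv (R := R) (M := LinearMap.range t) (N := LinearMap.ker l) e
    exact Module.finitePresentation_of_ker l hl

theorem isFinitelyPresentedOfOrder_two_of_finitePresentation {P₀ : Type u} [AddCommGroup P₀]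
    [Module R P₀] [Module.Finite R P₀] [Module.Projective R P₀] (K : Submodule R P₀)
    [Module.FinitePresentation R K] :
    IsFinitelyPresentedOfOrder 2 (ModuleCat.of R (P₀ ⧸ K)) := by
  obtain ⟨n, p, hp⟩ := Module.Finite.exists_fin' R K
  have : Module.Finite R (LinearMap.ker p) :=
    Module.Finite.iff_fg.2 (Module.FinitePresentation.fg_ker p hp)
  obtain ⟨m, q, hq⟩ := Module.Finite.exists_fin' R (LinearMap.ker p)
  let F : ℕ → ModuleCat.{u} R
    | 0 => ModuleCat.of R P₀
    | 1 => ModuleCat.of R (Fin n → R)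
    | _ + 2 => ModuleCat.of R (Fin m → R)
  let d : ∀ i, F (i + 1) →ₗ[R] F i
    | 0 => K.subtype ∘ₗ p
    | 1 => (LinearMap.ker p).subtype ∘ₗ q
    | _ + 2 => 0
  refine ⟨F, d, K.mkQ, ?_, K.mkQ_surjective, fun _ => ?_, ?_⟩
  · intro i hi
    interval_cases i
    · exact ⟨‹_›, ‹_›⟩
    · exact ⟨inferInstanceAs (Module.Finite R (Fin n → R)),
        inferInstanceAs (Module.Projective R (Fin n → R))⟩
    · exact ⟨inferInstanceAs (Module.Finite R (Fin m → R)),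
        inferInstanceAs (Module.Projective R (Fin m → R))⟩
  · refine LinearMap.exact_iff.2 ?_
    change LinearMap.ker K.mkQ = LinearMap.range (K.subtype ∘ₗ p)
    rw [LinearMap.range_comp_of_range_eq_top _ (LinearMap.range_eq_top.2 hp), K.ker_mkQ,
      K.range_subtype]
  · intro i hi
    obtain rfl : i = 0 := by lia
    refine LinearMap.exact_iff.2 ?_
    change LinearMap.ker (K.subtype ∘ₗ p) = LinearMap.range ((LinearMap.ker p).subtype ∘ₗ q)
    rw [LinearMap.range_comp_of_range_eq_top _ (LinearMap.range_eq_top.2 hq),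
      Submodule.range_subtype, LinearMap.ker_comp_of_ker_eq_bot _ K.ker_subtype]

theorem exists_fg_lTensor_eq (M : Type u) [AddCommGroup M] [Module Rᵐᵒᵖ M] {L : Type u}
    [AddCommGroup L] [Module R L] (x : BalancedTensor R M L) :
    ∃ Q : Submodule R L, Q.FG ∧ ∃ y, BalancedTensor.lTensor M Q.subtype y = x := by
  induction x using BalancedTensor.induction_on with
  | zero => exact ⟨⊥, Submodule.fg_bot, 0, map_zero _⟩
  | tmul m n =>
    exact ⟨R ∙ n, Submodule.fg_span_singleton n,
      BalancedTensor.tmul R m ⟨n, Submodule.mem_span_singleton_self n⟩, rfl⟩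
  | add x x' hx hx' =>
    obtain ⟨Q, hQ, y, rfl⟩ := hx
    obtain ⟨Q', hQ', y', rfl⟩ := hx'
    refine ⟨Q ⊔ Q', hQ.sup hQ',
      BalancedTensor.lTensor M (Submodule.inclusion le_sup_left) y +
      BalancedTensor.lTensor M (Submodule.inclusion le_sup_right) y', ?_⟩
    rw [map_add, ← BalancedTensor.lTensor_comp_apply, ← BalancedTensor.lTensor_comp_apply]
    rfl

/-- A finitely generated submodule of a free module is contained in a finite free direct
summand. -/
theorem exists_finite_free_summand {X : Type u} (Q : Submodule R (X →₀ R)) (hQ : Q.FG) :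
    ∃ (n : ℕ) (a : (Fin n → R) →ₗ[R] (X →₀ R)) (b : (X →₀ R) →ₗ[R] (Fin n → R)),
      b ∘ₗ a = LinearMap.id ∧ Q ≤ LinearMap.range a := by
  classical
  obtain ⟨S, rfl⟩ := hQ
  let s : Finset X := S.biUnion Finsupp.support
  let f : Fin s.card → X := fun i => s.equivFin.symm i
  have hf : Function.Injective f := Subtype.val_injective.comp s.equivFin.symm.injective
  let e := Finsupp.linearEquivFunOnFinite R R (Fin s.card)
  refine ⟨s.card, Finsupp.lmapDomain R R f ∘ₗ e.symm.toLinearMap,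
    e.toLinearMap ∘ₗ Finsupp.lcomapDomain f hf, ?_, ?_⟩
  · refine LinearMap.ext fun v => ?_
    change e (Finsupp.comapDomain f (Finsupp.mapDomain f (e.symm v)) hf.injOn) = v
    rw [Finsupp.comapDomain_mapDomain _ hf, e.apply_symm_apply]
  · rw [Submodule.span_le]
    intro v hv
    refine ⟨e (Finsupp.comapDomain f v hf.injOn), ?_⟩
    change Finsupp.mapDomain f (e.symm (e (Finsupp.comapDomain f v hf.injOn))) = v
    rw [e.symm_apply_apply, Finsupp.mapDomain_comapDomain f hf]
    intro x hx
    have hxs : x ∈ s := Finset.mem_biUnion.2 ⟨v, hv, hx⟩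
    exact ⟨s.equivFin ⟨x, hxs⟩, by simp [f]⟩

/-- Over a left coherent ring, `FP_2`-flat right modules are flat. -/
theorem IsLeftCoherent.isZero_tor_one (hR : IsLeftCoherent R) {M : ModuleCat.{u} Rᵐᵒᵖ}
    (hM : fpFlatRight R 2 M) (N : ModuleCat.{u} R) : IsZero (Tor 1 M N) := by
  rw [isZero_tor_one_iff_freeKernel, injective_iff_map_eq_zero]
  intro x hx
  -- The tensor `x` involves only a finitely generated part `Q` of the kernel, which sits in a
  -- finite free summand `R^n` of the free cover.
  obtain ⟨Q, hQ, y, rfl⟩ := exists_fg_lTensor_eq M x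
  obtain ⟨n, a, b, hba, ha⟩ : ∃ (n : ℕ)
      (a : (Fin n → R) →ₗ[R] (ModuleCat.free R).obj ((forget (ModuleCat.{u} R)).obj N))
      (b : (ModuleCat.free R).obj ((forget (ModuleCat.{u} R)).obj N) →ₗ[R] (Fin n → R)),
      b ∘ₗ a = LinearMap.id ∧ Q.map (freeKernel N).subtype ≤ LinearMap.range a :=
    exists_finite_free_summand (X := N) (Q.map (freeKernel N).subtype) (hQ.map _)
  have ha_inj : Function.Injective a :=
    Function.LeftInverse.injective (g := b) (LinearMap.congr_fun hba)
  obtain ⟨i, hi⟩ := exists_comp_eq_of_exact ha_inj (LinearMap.exact_map_mkQ_range a)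
    ((freeKernel N).subtype ∘ₗ Q.subtype) fun q =>
      (Submodule.Quotient.mk_eq_zero _).2 (ha ⟨q, q.2, rfl⟩)
  have hai : a ∘ₗ i = (freeKernel N).subtype ∘ₗ Q.subtype := LinearMap.ext hi
  have hi_inj : Function.Injective i := by
    refine Function.Injective.of_comp (f := a) ?_
    rw [← LinearMap.coe_comp, hai]
    exact (Submodule.injective_subtype _).comp (Submodule.injective_subtype _)
  have : Module.Finite R Q := Module.Finite.iff_fg.2 hQ
  have : Module.FinitePresentation R (LinearMap.range i) :=
    hR.finitePresentation_of_fg _ _ (by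
      rw [LinearMap.range_eq_map]
      exact Module.Finite.fg_top.map _)
  -- By coherence `R^n / Q` is finitely 2-presented, so `M ⊗ Q → M ⊗ R^n` is injective; `M ⊗ a` is
  -- injective because `a` splits.
  have hinj := (isZero_tor_one_iff M (ModuleCat.of R ((Fin n → R) ⧸ LinearMap.range i)) hi_inj
    (f := (LinearMap.range i).mkQ) (LinearMap.exact_map_mkQ_range i)
    (Submodule.mkQ_surjective _)).1
    (hM _ (isFinitelyPresentedOfOrder_two_of_finitePresentation _))
  rw [← BalancedTensor.lTensor_comp_apply, ← hai, BalancedTensor.lTensor_comp_apply,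
    map_eq_zero_iff _ (BalancedTensor.lTensor_injective_of_comp_eq_id hba),
    map_eq_zero_iff _ hinj] at hx
  rw [hx, map_zero]

end Coherent

end VogelRegular

theorem mainTheorem11 (R : Type u) [Ring R] (hR : VogelRegular.IsLeftVogelRegular R) :
    (∃ n : ℕ, 2 ≤ n ∧
      VogelRegular.HasTwoOutOfThree
        (VogelRegular.torOrthogonal (VogelRegular.fpFlatRight R n))) ↔
      VogelRegular.IsLeftCoherent R := by
  constructor
  · rintro ⟨n, hn, h⟩
    have htop := hR _ (VogelRegular.isVogelClass_torOrthogonal h)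
    refine VogelRegular.isLeftCoherent_of_tor_pi fun ι N => ?_
    have hN : VogelRegular.torOrthogonal (VogelRegular.fpFlatRight R n) N := by
      rw [htop]
      trivial
    exact hN _ (VogelRegular.fpFlatRight_pi R ι hn)
  · intro hcoh
    have hall (N : ModuleCat.{u} R) :
        VogelRegular.torOrthogonal (VogelRegular.fpFlatRight R 2) N :=
      fun _ hM => hcoh.isZero_tor_one hM N
    exact ⟨2, le_rfl, fun S _ =>
      ⟨fun _ _ => hall S.X₃, fun _ _ => hall S.X₂, fun _ _ => hall S.X₁⟩⟩
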